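/- \textbf{Theorem (Schnorr--Stimm theorem for Bernoulli measures).} Let $A$ be a finite alphabet and let $\mu$ be a positive Bernoulli measure over $A^\omega$, given by a distribution $\mu : A \to (0,1]$ with $\sum_{a \in A} \mu(a) = 1$; for a word $w = a_0 \cdots a_{k-1} \in A^*$ write $\mu(w) = \prod_{j<k} \mu(a_j)$ (so $\mu(\epsilon)=1$ for the empty word $\epsilon$). For words $u, w$ with $|u| = k \le n = |w|$ let $\mathrm{freq}(u,w) = \frac{1}{n-k+1}\,\#\{\,i : 0 \le i \le n-k,\ w(i)w(i+1)\cdots w(i+k-1) = u\,\}$. A sequence $X = X(0)X(1)X(2)\cdots \in A^\omega$ is \emph{$\mu$-normal} if for every word $w \in A^*$ the limit $\lim_{n \to \infty} \mathrm{freq}(w, X(0)X(1)\cdots X(n))$ exists and equals $\mu(w)$. A \emph{(deterministic, finite-state) $\mu$-gambler} is a tuple $\mathcal G = (Q, A, q_I, \delta, \gamma)$ where $Q$ is a finite set of states, $q_I \in Q$ is the initial state, $\delta : Q \times A \to Q$ is the transition function, and $\gamma : Q \times A \to [0,\infty)$ satisfies the fairness condition $\sum_{a \in A} \mu(a)\gamma(q,a)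 = 1$ for every $q \in Q$. Let $\delta^*(q_I, w)$ be the state reached from $q_I$ after reading the word $w$. The capital of $\mathcal G$ is defined by $\mathrm{capital}(\mathcal G, \epsilon) = 1$ and $\mathrm{capital}(\mathcal G, wa) = \mathrm{capital}(\mathcal G, w)\cdot\gamma(\delta^*(q_I,w),a)$ for $w \in A^*$, $a \in A$. We say that $\mathcal G$ \emph{wins} against $X \in A^\omega$ if $\limsup_{n\to\infty} \mathrm{capital}(\mathcal G, X(0)X(1)\cdots X(n)) = +\infty$. Then for every $X \in A^\omega$ the following are equivalent: (i) $X$ is $\mu$-normal; (ii) no $\mu$-gambler wins against $X$. -/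

import Mathlib

open Filter

namespace BernoulliGambling

/-- A probability distribution on a finite alphabet `A`. It is identified with the Bernoulli
measure on `ℕ → A` under which the letters are drawn independently according to it. -/
structure LetterDistribution (A : Type*) [Fintype A] where
  /-- The probability of a letter. -/
  prob : A → ℝ
  prob_nonneg : ∀ a, 0 ≤ prob a
  sum_prob : ∑ a, prob a = 1

section

variable {A : Type*}

/-- Every letter has positive probability. -/
def LetterDistribution.IsPositive [Fintype A] (μ : LetterDistribution A) : Prop :=
  ∀ a, 0 < μ.prob a

/-- The measure `μ(w)` of (the cylinder of) a word: the product of the probabilities of its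
letters. The empty word has measure `1`. -/
def LetterDistribution.word [Fintype A] (μ : LetterDistribution A) (w : List A) : ℝ :=
  (w.map μ.prob).prod

/-- The word `X[0..n] = X(0) X(1) … X(n)`, of length `n + 1`. -/
def initialWord (X : ℕ → A) (n : ℕ) : List A :=
  (List.range (n + 1)).map X

/-- The number of (possibly overlapping) occurrences of the word `u` in the word `w`, that is the
number of positions `0 ≤ i ≤ |w| - |u|` at which the factor of `w` of length `|u|` is `u`
(there are none if `|w| < |u|`). -/
def occurrences [DecidableEq A] (u w : List A) : ℕ :=
  ((Finset.range (w.length + 1 - u.length)).filter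
    (fun i => (w.drop i).take u.length = u)).card

/-- The frequency of `u` in `w`: the proportion of positions at which `u` occurs
(it is `0` if `|w| < |u|`). -/
noncomputable def freq [DecidableEq A] (u w : List A) : ℝ :=
  (occurrences u w : ℝ) / ((w.length : ℝ) - (u.length : ℝ) + 1)

/-- The lower frequency of the word `u` in the sequence `X`. -/
noncomputable def lowerFreq [DecidableEq A] (u : List A) (X : ℕ → A) : ℝ :=
  liminf (fun n => freq u (initialWord X n)) atTop

/-- The upper frequency of the word `u` in the sequence `X`. -/
noncomputable def upperFreq [DecidableEq A] (u : List A) (X : ℕ → A) : ℝ :=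
  limsup (fun n => freq u (initialWord X n)) atTop

/-- The frequency of `u` in `X` exists and is equal to `r`. -/
def HasFreq [DecidableEq A] (u : List A) (X : ℕ → A) (r : ℝ) : Prop :=
  lowerFreq u X = r ∧ upperFreq u X = r

/-- `X` is `μ`-normal: every word `w` has frequency `μ(w)` in `X`. -/
def IsNormal [Fintype A] [DecidableEq A] (μ : LetterDistribution A) (X : ℕ → A) : Prop :=
  ∀ w : List A, HasFreq w X (μ.word w)

end

/-- A deterministic automaton over the alphabet `A` with state set `Q`, without final states. -/
structure Automaton (A Q : Type*) where
  /-- The initial state. -/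
  start : Q
  /-- The transition function. -/
  step : Q → A → Q

/-- The state reached from `q` by reading a word. -/
def Automaton.run {A Q : Type*} (M : Automaton A Q) (q : Q) (w : List A) : Q :=
  w.foldl M.step q

/-- A `μ`-gambler with state set `Q`: a deterministic automaton together with nonnegative
multipliers `bet q a` which are fair with respect to `μ` in every state. -/
structure Gambler {A : Type*} [Fintype A] (μ : LetterDistribution A) (Q : Type*) extends
    Automaton A Q where
  /-- The factor by which the capital is multiplied when the letter `a` is read in state `q`. -/
  bet : Q → A → ℝ
  bet_nonneg : ∀ q a, 0 ≤ bet q a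
  fair : ∀ q, ∑ a, μ.prob a * bet q a = 1

section

variable {A Q : Type*} [Fintype A] {μ : LetterDistribution A}

/-- The factor by which the capital is multiplied when a word is read from the state `q`. -/
def Gambler.capitalFrom (G : Gambler μ Q) : Q → List A → ℝ
  | _, [] => 1
  | q, a :: w => G.bet q a * G.capitalFrom (G.step q a) w

/-- The capital of the gambler after reading a word, the initial capital being `1`. -/
def Gambler.capital (G : Gambler μ Q) (w : List A) : ℝ :=
  G.capitalFrom G.start w

theorem Gambler.capital_nil (G : Gambler μ Q) : G.capital [] = 1 := rfl

theorem Gambler.capitalFrom_concat (G : Gambler μ Q) (w : List A) (a : A) (q : Q) :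
    G.capitalFrom q (w ++ [a]) =
      G.capitalFrom q w * G.bet (G.toAutomaton.run q w) a := by
  induction w generalizing q with
  | nil => simp [Gambler.capitalFrom, Automaton.run]
  | cons b w ih => simp [Gambler.capitalFrom, Automaton.run, ih, mul_assoc]

/-- The inductive description of the capital: reading one more letter multiplies it by the bet
placed on this letter in the current state. -/
theorem Gambler.capital_concat (G : Gambler μ Q) (w : List A) (a : A) :
    G.capital (w ++ [a]) = G.capital w * G.bet (G.toAutomaton.run G.start w) a :=
  G.capitalFrom_concat w a G.start

/-- The gambler wins against `X`: the limit superior, in the extended reals, of its capital along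
the initial words of `X` is `+∞`. -/
def Gambler.WinsAgainst (G : Gambler μ Q) (X : ℕ → A) : Prop :=
  limsup (fun n => ((G.capital (initialWord X n) : ℝ) : EReal)) atTop = ⊤

end

end BernoulliGambling

/-! No winner implies normality: if the frequency of `ua` infinitely often differs by a fixed amount
from `μ(a)` times that of `u`, then betting a small fraction `ε` for or against `a` after each `u`
wins. The gain in log-capital is of order `ε` per position and the loss only `O(ε²)`. So these
differences tend to 0, and induction on the word gives normality.

Normality implies no winner: a gambler that reaches an inert state has frozen capital. Otherwise
consider the square root of the capital. The square root of a fair bet has mean below 1 unless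
nothing is bet, so, once moves into inert states are assigned the factor 0, its mean over words of
length `k` tends to 0 from every state (`Gambler.tendsto_meanRootCapital`). Choose `k` so that the
sum of these means over all states is below 1. This sum controls a window whatever the current
state, so word frequencies suffice and state frequencies are never needed: the product of the gains
over all windows of length `k` is eventually at most 1. It telescopes to a bound on products of `k`
consecutive root capitals, and since bets are bounded, on each of them. -/

namespace BernoulliGambling

open Topology

/-! ### Windows, frequencies and averages -/

section

variable {A : Type*}

/-- The factor of length `k` of the sequence `X` starting at position `i`. -/
def window (X : ℕ → A) (i k : ℕ) : List A :=
  (List.range k).map fun j => X (i + j)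

@[simp]
theorem length_window (X : ℕ → A) (i k : ℕ) : (window X i k).length = k := by
  simp [window]

theorem window_zero (X : ℕ → A) (i : ℕ) : window X i 0 = [] := rfl

theorem window_succ (X : ℕ → A) (i k : ℕ) :
    window X i (k + 1) = window X i k ++ [X (i + k)] := by
  simp [window, List.range_succ]

theorem window_succ_left (X : ℕ → A) (i k : ℕ) :
    window X i (k + 1) = X i :: window X (i + 1) k := by
  simp [window, List.range_succ_eq_map, Function.comp_def, Nat.add_comm, Nat.add_left_comm]

theorem window_add (X : ℕ → A) (i j k : ℕ) :
    window X i (j + k) = window X i j ++ window X (i + j) k := by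
  simp [window, List.range_add, Function.comp_def, Nat.add_assoc]

theorem initialWord_eq_window (X : ℕ → A) (n : ℕ) : initialWord X n = window X 0 (n + 1) := by
  simp [window, initialWord]

theorem take_drop_window (X : ℕ → A) {i k n : ℕ} (h : i + k ≤ n) :
    ((window X 0 n).drop i).take k = window X i k := by
  apply List.ext_getElem
  · simp; omega
  · intro j h1 h2
    simp [window]

theorem LetterDistribution.word_nil [Fintype A] (μ : LetterDistribution A) : μ.word [] = 1 := by
  simp [LetterDistribution.word]

theorem LetterDistribution.word_cons [Fintype A] (μ : LetterDistribution A) (a : A) (w : List A) :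
    μ.word (a :: w) = μ.prob a * μ.word w := by
  simp [LetterDistribution.word]

theorem LetterDistribution.word_concat [Fintype A] (μ : LetterDistribution A) (a : A)
    (w : List A) : μ.word (w ++ [a]) = μ.word w * μ.prob a := by
  simp [LetterDistribution.word]

theorem LetterDistribution.prob_le_one [Fintype A] (μ : LetterDistribution A) (a : A) : μ.prob a ≤ 1 := by
  rw [← μ.sum_prob]
  exact Finset.single_le_sum (fun b _ => μ.prob_nonneg b) (Finset.mem_univ a)

variable [DecidableEq A]

/-- The indicator of the occurrence of `u` in `X` at position `i`. -/
def hit (X : ℕ → A) (u : List A) (i : ℕ) : ℝ :=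
  if window X i u.length = u then 1 else 0

/-- The proportion of the first `n` positions of `X` at which `u` occurs. -/
noncomputable def hitMean (X : ℕ → A) (u : List A) (n : ℕ) : ℝ :=
  (∑ i ∈ Finset.range n, hit X u i) / n

theorem hit_nonneg (X : ℕ → A) (u : List A) (i : ℕ) : 0 ≤ hit X u i := by
  unfold hit; split_ifs <;> norm_num

theorem hit_le_one (X : ℕ → A) (u : List A) (i : ℕ) : hit X u i ≤ 1 := by
  unfold hit; split_ifs <;> norm_num

theorem hitMean_nonneg (X : ℕ → A) (u : List A) (n : ℕ) : 0 ≤ hitMean X u n :=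
  div_nonneg (Finset.sum_nonneg fun i _ => hit_nonneg X u i) n.cast_nonneg

theorem hitMean_le_one (X : ℕ → A) (u : List A) (n : ℕ) : hitMean X u n ≤ 1 := by
  apply div_le_one_of_le₀ _ n.cast_nonneg
  simpa using Finset.sum_le_sum fun i (_ : i ∈ Finset.range n) => hit_le_one X u i

/-- `initialWord X m` has `m + 1` letters, which leaves `n + 2` starting positions. -/
theorem freq_initialWord (X : ℕ → A) (u : List A) (n : ℕ) :
    freq u (initialWord X (n + u.length)) = hitMean X u (n + 2) := by
  have h : n + u.length + 1 + 1 - u.length = n + 2 := by omega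
  rw [initialWord_eq_window, freq, hitMean, occurrences, length_window, h]
  congr 1
  · rw [Finset.card_filter, Nat.cast_sum]
    refine Finset.sum_congr rfl fun i hi => ?_
    rw [Finset.mem_range] at hi
    rw [take_drop_window X (by omega), hit, Nat.cast_ite, Nat.cast_one, Nat.cast_zero]
  · push_cast; ring

theorem hasFreq_iff_tendsto (X : ℕ → A) (u : List A) (r : ℝ) :
    HasFreq u X r ↔ Tendsto (hitMean X u) atTop (𝓝 r) := by
  have hshift : Tendsto (hitMean X u) atTop (𝓝 r) ↔
      Tendsto (fun n => freq u (initialWord X n)) atTop (𝓝 r) := by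
    rw [← tendsto_add_atTop_iff_nat (f := hitMean X u) 2,
      ← tendsto_add_atTop_iff_nat (f := fun n => freq u (initialWord X n)) u.length]
    simp only [freq_initialWord]
  -- Real `liminf` and `limsup` determine convergence only together with boundedness.
  have hev : ∀ᶠ n in atTop, 0 ≤ freq u (initialWord X n) ∧ freq u (initialWord X n) ≤ 1 := by
    filter_upwards [eventually_ge_atTop u.length] with n hn
    obtain ⟨m, rfl⟩ := Nat.exists_eq_add_of_le' hn
    rw [freq_initialWord]
    exact ⟨hitMean_nonneg X u _, hitMean_le_one X u _⟩
  rw [hshift]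
  constructor
  · rintro ⟨h1, h2⟩
    exact tendsto_of_le_liminf_of_limsup_le h1.ge h2.le
      ⟨1, hev.mono fun n h => h.2⟩ ⟨0, hev.mono fun n h => h.1⟩
  · exact fun h => ⟨h.liminf_eq, h.limsup_eq⟩

theorem isNormal_iff_tendsto [Fintype A] (μ : LetterDistribution A) (X : ℕ → A) :
    IsNormal μ X ↔ ∀ u, Tendsto (hitMean X u) atTop (𝓝 (μ.word u)) :=
  forall_congr' fun u => hasFreq_iff_tendsto X u _

theorem hit_concat (X : ℕ → A) (u : List A) (a : A) (i : ℕ) :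
    hit X (u ++ [a]) i = hit X u i * if X (i + u.length) = a then 1 else 0 := by
  have : window X i (u ++ [a]).length = u ++ [a] ↔
      window X i u.length = u ∧ X (i + u.length) = a := by
    rw [List.length_append, List.length_singleton, window_succ]
    constructor
    · intro h
      have := List.append_inj h (by simp)
      simpa using this
    · rintro ⟨h1, h2⟩
      rw [h1, h2]
  simp only [hit, this]
  split_ifs <;> simp_all

/-- Window averages of a normal sequence converge to the corresponding expectation. -/
theorem IsNormal.tendsto_mean [Fintype A] {μ : LetterDistribution A} {X : ℕ → A}
    (h : IsNormal μ X) (k : ℕ) (F : List A → ℝ) :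
    Tendsto (fun n : ℕ => (∑ i ∈ Finset.range n, F (window X i k)) / n) atTop
      (𝓝 (∑ w : Fin k → A, μ.word (List.ofFn w) * F (List.ofFn w))) := by
  rw [isNormal_iff_tendsto] at h
  have key : ∀ i, F (window X i k) =
      ∑ w : Fin k → A, hit X (List.ofFn w) i * F (List.ofFn w) := by
    intro i
    have hw : window X i k = List.ofFn fun j : Fin k => X (i + j) := by
      apply List.ext_getElem <;> simp [window]
    rw [Finset.sum_eq_single fun j : Fin k => X (i + j)]
    · rw [← hw]; simp [hit]
    · intro w _ hne
      have : window X i (List.ofFn w).length ≠ List.ofFn w := by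
        rw [List.length_ofFn, hw]
        exact fun h => hne (List.ofFn_injective h).symm
      rw [hit, if_neg this, zero_mul]
    · simp
  have : (fun n : ℕ => (∑ i ∈ Finset.range n, F (window X i k)) / (n : ℝ)) = fun n =>
      ∑ w : Fin k → A, hitMean X (List.ofFn w) n * F (List.ofFn w) := by
    funext n
    simp only [key, hitMean]
    rw [Finset.sum_comm, Finset.sum_div]
    refine Finset.sum_congr rfl fun w _ => ?_
    rw [← Finset.sum_mul]
    ring
  rw [this]
  exact tendsto_finsetSum _ fun w _ => (h _).mul_const _

end

/-! ### Gamblers along a sequence -/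

section

variable {A Q : Type*} [Fintype A] {μ : LetterDistribution A}

/-- The state of the gambler after reading the first `n` letters of `X`. -/
def Gambler.stateAt (G : Gambler μ Q) (X : ℕ → A) (n : ℕ) : Q :=
  G.toAutomaton.run G.start (window X 0 n)

/-- The capital of the gambler after reading the first `n` letters of `X`. -/
def Gambler.capitalAt (G : Gambler μ Q) (X : ℕ → A) (n : ℕ) : ℝ :=
  G.capital (window X 0 n)

theorem Gambler.stateAt_zero (G : Gambler μ Q) (X : ℕ → A) : G.stateAt X 0 = G.start := rfl

theorem Gambler.stateAt_succ (G : Gambler μ Q) (X : ℕ → A) (n : ℕ) :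
    G.stateAt X (n + 1) = G.step (G.stateAt X n) (X n) := by
  simp [Gambler.stateAt, window_succ, Automaton.run]

theorem Gambler.capitalAt_zero (G : Gambler μ Q) (X : ℕ → A) : G.capitalAt X 0 = 1 := rfl

theorem Gambler.capitalAt_succ (G : Gambler μ Q) (X : ℕ → A) (n : ℕ) :
    G.capitalAt X (n + 1) = G.capitalAt X n * G.bet (G.stateAt X n) (X n) := by
  simp [Gambler.capitalAt, window_succ, Gambler.capital_concat, Gambler.stateAt]

theorem Gambler.capitalAt_eq_prod (G : Gambler μ Q) (X : ℕ → A) (n : ℕ) :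
    G.capitalAt X n = ∏ i ∈ Finset.range n, G.bet (G.stateAt X i) (X i) := by
  induction n with
  | zero => simp [Gambler.capitalAt_zero]
  | succ n ih => rw [Gambler.capitalAt_succ, Finset.prod_range_succ, ih]

theorem Gambler.winsAgainst_of_frequently (G : Gambler μ Q) (X : ℕ → A)
    (h : ∀ B : ℝ, ∃ᶠ n in atTop, B ≤ G.capitalAt X n) : G.WinsAgainst X := by
  rw [Gambler.WinsAgainst, EReal.eq_top_iff_forall_lt]
  intro B
  refine lt_of_lt_of_le (EReal.coe_lt_coe_iff.2 (lt_add_one B)) ?_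
  refine le_limsup_of_frequently_le ?_ (by isBoundedDefault)
  have := (h (B + 1)).and_eventually (eventually_ge_atTop 1)
  rw [frequently_atTop] at this ⊢
  intro N
  obtain ⟨n, hn, hB, h1⟩ := this (N + 1)
  refine ⟨n - 1, by omega, ?_⟩
  rw [initialWord_eq_window, Nat.sub_add_cancel h1]
  exact EReal.coe_le_coe_iff.2 hB

theorem Gambler.not_winsAgainst_of_eventually_le (G : Gambler μ Q) (X : ℕ → A) (B : ℝ)
    (h : ∀ᶠ n in atTop, G.capitalAt X n ≤ B) : ¬ G.WinsAgainst X := by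
  intro hw
  have : limsup (fun n => ((G.capital (initialWord X n) : ℝ) : EReal)) atTop ≤ (B : EReal) := by
    apply limsup_le_of_le
    · isBoundedDefault
    · filter_upwards [(tendsto_add_atTop_nat 1).eventually h] with n hn
      rw [initialWord_eq_window]
      exact EReal.coe_le_coe_iff.2 hn
  rw [hw] at this
  exact EReal.coe_ne_top B (top_le_iff.1 this)

/-- Renaming of the states of a gambler. -/
def Gambler.rename {Q' : Type*} (G : Gambler μ Q) (e : Q ≃ Q') : Gambler μ Q' where
  start := e G.start
  step q a := e (G.step (e.symm q) a)
  bet q a := G.bet (e.symm q) a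
  bet_nonneg _ _ := G.bet_nonneg _ _
  fair _ := G.fair _

theorem Gambler.capitalFrom_rename {Q' : Type*} (G : Gambler μ Q) (e : Q ≃ Q') (w : List A)
    (q : Q) : (G.rename e).capitalFrom (e q) w = G.capitalFrom q w := by
  induction w generalizing q with
  | nil => rfl
  | cons a w ih => simp [Gambler.capitalFrom, Gambler.rename, ← ih]

theorem Gambler.winsAgainst_rename_iff {Q' : Type*} (G : Gambler μ Q) (e : Q ≃ Q') (X : ℕ → A) :
    (G.rename e).WinsAgainst X ↔ G.WinsAgainst X := by
  have : ∀ w, (G.rename e).capital w = G.capital w := fun w => G.capitalFrom_rename e w G.start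
  simp only [Gambler.WinsAgainst, this]

end

/-! ### Suffix gamblers: no winner implies normality -/

section

variable {A : Type*} [Fintype A] [DecidableEq A]

/-- The deviation of the indicator of the letter `a` from its mean. -/
def LetterDistribution.deviation (μ : LetterDistribution A) (a b : A) : ℝ :=
  (if b = a then 1 else 0) - μ.prob a

theorem LetterDistribution.abs_deviation_le_one (μ : LetterDistribution A) (a b : A) :
    |μ.deviation a b| ≤ 1 := by
  have h0 := μ.prob_nonneg a
  have h1 := μ.prob_le_one a
  rw [abs_le, LetterDistribution.deviation]
  split_ifs <;> constructor <;> linarith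

theorem LetterDistribution.sum_prob_mul_deviation (μ : LetterDistribution A) (a : A) :
    ∑ b, μ.prob b * μ.deviation a b = 0 := by
  simp [LetterDistribution.deviation, mul_sub, Finset.sum_sub_distrib, ← Finset.sum_mul,
    μ.sum_prob]

/-- The gambler who remembers the last `|u|` letters, in reverse order, and who bets the
fraction `ε` of the capital on the letter `a` each time these letters form the word `u`. -/
noncomputable def suffixGambler (μ : LetterDistribution A) (u : List A) (a : A) (ε : ℝ)
    (hε : |ε| ≤ 1) : Gambler μ {l : List A // l.length ≤ u.length} where
  start := ⟨[], Nat.zero_le _⟩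
  step l b := ⟨(b :: l.1).take u.length, by simp⟩
  bet l b := if l.1 = u.reverse then 1 + ε * μ.deviation a b else 1
  bet_nonneg l b := by
    split_ifs
    · have : |ε * μ.deviation a b| ≤ 1 := by
        rw [abs_mul]
        exact mul_le_one₀ hε (abs_nonneg _) (μ.abs_deviation_le_one a b)
      linarith [(abs_le.1 this).1]
    · exact zero_le_one
  fair l := by
    split_ifs
    · simp only [mul_add, mul_one, Finset.sum_add_distrib, μ.sum_prob, mul_left_comm _ ε,
        ← Finset.mul_sum, μ.sum_prob_mul_deviation, mul_zero, add_zero]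
    · simp [μ.sum_prob]

theorem suffixGambler_stateAt (μ : LetterDistribution A) (u : List A) (a : A) (ε : ℝ)
    (hε : |ε| ≤ 1) (X : ℕ → A) (n : ℕ) :
    ((suffixGambler μ u a ε hε).stateAt X n).1 = (window X 0 n).reverse.take u.length := by
  induction n with
  | zero => simp [Gambler.stateAt_zero, window_zero, suffixGambler]
  | succ n ih =>
    rw [Gambler.stateAt_succ]
    change (X n :: ((suffixGambler μ u a ε hε).stateAt X n).1).take u.length = _
    rw [ih, window_succ, List.reverse_append]
    cases u.length with
    | zero => simp
    | succ k => simp [List.take_take]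

theorem suffixGambler_stateAt_eq_iff (μ : LetterDistribution A) (u : List A) (a : A) (ε : ℝ)
    (hε : |ε| ≤ 1) (X : ℕ → A) (n : ℕ) :
    ((suffixGambler μ u a ε hε).stateAt X (u.length + n)).1 = u.reverse ↔
      window X n u.length = u := by
  rw [suffixGambler_stateAt, Nat.add_comm, window_add, List.reverse_append, Nat.zero_add,
    List.take_left' (by simp), List.reverse_inj]

theorem suffixGambler_capitalAt (μ : LetterDistribution A) (u : List A) (a : A) (ε : ℝ)
    (hε : |ε| ≤ 1) (X : ℕ → A) (n : ℕ) :
    (suffixGambler μ u a ε hε).capitalAt X (u.length + n) =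
      ∏ i ∈ Finset.range n, (1 + ε * (hit X u i * μ.deviation a (X (i + u.length)))) := by
  set G := suffixGambler μ u a ε hε with hG
  have hbet : ∀ l b, G.bet l b = if l.1 = u.reverse then 1 + ε * μ.deviation a b else 1 :=
    fun _ _ => rfl
  rw [Gambler.capitalAt_eq_prod, Finset.prod_range_add]
  -- During the first `|u|` steps the memory is shorter than `u`, so nothing is bet.
  have h1 : ∏ i ∈ Finset.range u.length, G.bet (G.stateAt X i) (X i) = 1 := by
    refine Finset.prod_eq_one fun i hi => ?_
    rw [hbet, if_neg]
    intro h
    rw [hG, suffixGambler_stateAt] at h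
    have := congrArg List.length h
    simp at this hi
    omega
  rw [h1, one_mul]
  refine Finset.prod_congr rfl fun i _ => ?_
  rw [hbet, hG]
  simp only [suffixGambler_stateAt_eq_iff, hit, Nat.add_comm i]
  split_ifs <;> simp

/-- From `log (1 + x) ≥ 1 - 1 / (1 + x)`; the remaining difference is nonnegative because `1 + 2x ≥
0`. -/
theorem exp_sub_two_mul_sq_le_one_add {x : ℝ} (h : |x| ≤ 1 / 2) :
    Real.exp (x - 2 * x ^ 2) ≤ 1 + x := by
  obtain ⟨h1, h2⟩ := abs_le.1 h
  have hpos : 0 < 1 + x := by linarith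
  rw [← Real.le_log_iff_exp_le hpos]
  refine le_trans ?_ (Real.one_sub_inv_le_log_of_pos hpos)
  have : 1 - (1 + x)⁻¹ - (x - 2 * x ^ 2) = x ^ 2 * (1 + 2 * x) / (1 + x) := by
    field_simp; ring
  have h3 : 0 ≤ x ^ 2 * (1 + 2 * x) / (1 + x) :=
    div_nonneg (mul_nonneg (sq_nonneg x) (by linarith)) hpos.le
  linarith

theorem exp_le_suffixGambler_capitalAt (μ : LetterDistribution A) (u : List A) (a : A) {ε : ℝ}
    (hε : |ε| ≤ 1) (hε' : |ε| ≤ 1 / 2) (X : ℕ → A) (n : ℕ) :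
    Real.exp (n * (ε * (hitMean X (u ++ [a]) n - hitMean X u n * μ.prob a) - 2 * ε ^ 2)) ≤
      (suffixGambler μ u a ε hε).capitalAt X (u.length + n) := by
  rcases Nat.eq_zero_or_pos n with rfl | hn
  · rw [suffixGambler_capitalAt]
    simp
  set y : ℕ → ℝ := fun i => hit X u i * μ.deviation a (X (i + u.length)) with hy
  have hy1 : ∀ i, |y i| ≤ 1 := fun i => by
    rw [hy, abs_mul]
    exact mul_le_one₀ (by rw [abs_of_nonneg (hit_nonneg _ _ _)]; exact hit_le_one _ _ _)
      (abs_nonneg _) (μ.abs_deviation_le_one _ _)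
  have hsum : ∑ i ∈ Finset.range n, (ε * y i - 2 * ε ^ 2) =
      n * (ε * (hitMean X (u ++ [a]) n - hitMean X u n * μ.prob a) - 2 * ε ^ 2) := by
    have hn' : (n : ℝ) ≠ 0 := by positivity
    have : ∀ i, y i = hit X (u ++ [a]) i - hit X u i * μ.prob a := fun i => by
      rw [hit_concat, ← mul_sub]; rfl
    simp only [this, hitMean, Finset.sum_sub_distrib, ← Finset.mul_sum, ← Finset.sum_mul,
      Finset.sum_const, Finset.card_range, nsmul_eq_mul]
    field_simp
  rw [suffixGambler_capitalAt, ← hsum, Real.exp_sum]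
  refine Finset.prod_le_prod (fun i _ => (Real.exp_pos _).le) fun i _ => ?_
  have h1 : |ε * y i| ≤ 1 / 2 := by
    rw [abs_mul]
    exact (mul_le_of_le_one_right (abs_nonneg _) (hy1 i)).trans hε'
  refine le_trans (Real.exp_le_exp.2 ?_) (exp_sub_two_mul_sq_le_one_add h1)
  have h2 : (ε * y i) ^ 2 ≤ ε ^ 2 := by
    rw [mul_pow]
    refine mul_le_of_le_one_right (sq_nonneg _) ?_
    rw [← sq_abs]
    exact pow_le_one₀ (abs_nonneg _) (hy1 i)
  linarith

/-- A linear gain of `4ε²` per position, less the quadratic loss `2ε²`, leaves growth by `exp (2ε²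
n)`. -/
theorem suffixGambler_winsAgainst (μ : LetterDistribution A) (u : List A) (a : A) {ε : ℝ}
    (hε : |ε| ≤ 1) (hε' : |ε| ≤ 1 / 2) (hε0 : ε ≠ 0) (X : ℕ → A)
    (h : ∃ᶠ n in atTop, 4 * ε ^ 2 ≤
      ε * (hitMean X (u ++ [a]) n - hitMean X u n * μ.prob a)) :
    (suffixGambler μ u a ε hε).WinsAgainst X := by
  apply Gambler.winsAgainst_of_frequently
  intro B
  have hpos : 0 < 2 * ε ^ 2 := by positivity
  have htend : Tendsto (fun n : ℕ => Real.exp (n * (2 * ε ^ 2))) atTop atTop :=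
    Real.tendsto_exp_atTop.comp (tendsto_natCast_atTop_atTop.atTop_mul_const hpos)
  have hf := h.and_eventually (htend.eventually_ge_atTop B)
  rw [frequently_atTop] at hf ⊢
  intro N
  obtain ⟨n, hn, h1, h2⟩ := hf N
  refine ⟨u.length + n, by omega, h2.trans (le_trans (Real.exp_le_exp.2 ?_)
    (exp_le_suffixGambler_capitalAt μ u a hε hε' X n))⟩
  exact mul_le_mul_of_nonneg_left (by linarith) n.cast_nonneg

theorem tendsto_hitMean_concat_sub (μ : LetterDistribution A) (X : ℕ → A) (u : List A) (a : A)
    (h : ∀ ε : ℝ, ∀ hε : |ε| ≤ 1, ¬ (suffixGambler μ u a ε hε).WinsAgainst X) :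
    Tendsto (fun n => hitMean X (u ++ [a]) n - hitMean X u n * μ.prob a) atTop (𝓝 0) := by
  rw [Metric.tendsto_nhds]
  intro η hη
  set D := fun n => hitMean X (u ++ [a]) n - hitMean X u n * μ.prob a with hD
  -- With `4ε ≤ η`, a deviation of at least `η` gives a gain of at least `4ε²`.
  obtain ⟨ε, hε0, hε1, hε2⟩ : ∃ ε : ℝ, 0 < ε ∧ ε ≤ 1 / 2 ∧ 4 * ε ≤ η :=
    ⟨min (1 / 2) (η / 4), by positivity, min_le_left _ _, by
      linarith [min_le_right (1 / 2) (η / 4)]⟩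
  have habs : |ε| = ε := abs_of_pos hε0
  have hup : ∀ᶠ n in atTop, D n < η := by
    by_contra hc
    refine h ε (by linarith) (suffixGambler_winsAgainst μ u a _ (by linarith) hε0.ne' X ?_)
    refine (not_eventually.1 hc).mono fun n hn => ?_
    have := mul_le_mul_of_nonneg_left (hε2.trans (not_lt.1 hn)) hε0.le
    linarith
  -- If `a` is too rare after `u`, the bet is placed against it.
  have hlow : ∀ᶠ n in atTop, -D n < η := by
    by_contra hc
    refine h (-ε) (by rw [abs_neg]; linarith) (suffixGambler_winsAgainst μ u a _
      (by rw [abs_neg]; linarith) (neg_ne_zero.2 hε0.ne') X ?_)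
    refine (not_eventually.1 hc).mono fun n hn => ?_
    have := mul_le_mul_of_nonneg_left (hε2.trans (not_lt.1 hn)) hε0.le
    linarith
  filter_upwards [hup, hlow] with n h1 h2
  rw [Real.dist_eq, sub_zero, abs_lt]
  exact ⟨by linarith, h1⟩

theorem isNormal_of_suffixGambler (μ : LetterDistribution A) (X : ℕ → A)
    (h : ∀ (u : List A) (a : A) (ε : ℝ) (hε : |ε| ≤ 1),
      ¬ (suffixGambler μ u a ε hε).WinsAgainst X) : IsNormal μ X := by
  rw [isNormal_iff_tendsto]
  intro w
  induction w using List.reverseRecOn with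
  | nil =>
    rw [μ.word_nil]
    refine tendsto_const_nhds.congr' ?_
    -- At `n = 0` the mean is `0 / 0 = 0`, not 1.
    filter_upwards [eventually_ge_atTop 1] with n hn
    have : (n : ℝ) ≠ 0 := by positivity
    simp [hitMean, hit, window_zero, this]
  | append_singleton u a ih =>
    rw [μ.word_concat]
    simpa using (tendsto_hitMean_concat_sub μ X u a (h u a)).add (ih.mul_const (μ.prob a))

end

/-! ### Root capital: normality implies no winner -/

section

variable {A Q : Type*} [Fintype A] {μ : LetterDistribution A}

/-- In an inert state, and in all states that can be reached from it, nothing is ever bet. -/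
def Gambler.Inert (G : Gambler μ Q) (q : Q) : Prop :=
  ∀ w a, G.bet (G.toAutomaton.run q w) a = 1

theorem Gambler.Inert.bet_eq_one {G : Gambler μ Q} {q : Q} (h : G.Inert q) (a : A) :
    G.bet q a = 1 := h [] a

theorem Gambler.Inert.step {G : Gambler μ Q} {q : Q} (h : G.Inert q) (a : A) :
    G.Inert (G.step q a) := fun w b => h (a :: w) b

open Classical in
/-- The square root of the bet, set to `0` when the next state is inert. -/
noncomputable def Gambler.rootBet (G : Gambler μ Q) (q : Q) (a : A) : ℝ :=
  if G.Inert (G.step q a) then 0 else √(G.bet q a)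

/-- The product of the values of `rootBet` along a word. -/
noncomputable def Gambler.rootCapital (G : Gambler μ Q) : Q → List A → ℝ
  | _, [] => 1
  | q, a :: w => G.rootBet q a * G.rootCapital (G.step q a) w

/-- The expectation of `rootCapital` over all words of length `k`. -/
noncomputable def Gambler.meanRootCapital (G : Gambler μ Q) : ℕ → Q → ℝ
  | 0, _ => 1
  | k + 1, q => ∑ a, μ.prob a * (G.rootBet q a * G.meanRootCapital k (G.step q a))

theorem Gambler.rootBet_nonneg (G : Gambler μ Q) (q : Q) (a : A) : 0 ≤ G.rootBet q a := by
  unfold Gambler.rootBet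
  split_ifs
  exacts [le_rfl, Real.sqrt_nonneg _]

theorem Gambler.rootBet_le (G : Gambler μ Q) (q : Q) (a : A) :
    G.rootBet q a ≤ √(G.bet q a) := by
  unfold Gambler.rootBet
  split_ifs
  exacts [Real.sqrt_nonneg _, le_rfl]

theorem Gambler.rootBet_of_inert (G : Gambler μ Q) {q : Q} (h : G.Inert q) (a : A) :
    G.rootBet q a = 0 := if_pos (h.step a)

theorem Gambler.rootCapital_nonneg (G : Gambler μ Q) (w : List A) (q : Q) :
    0 ≤ G.rootCapital q w := by
  induction w generalizing q with
  | nil => exact zero_le_one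
  | cons a w ih => exact mul_nonneg (G.rootBet_nonneg q a) (ih _)

theorem Gambler.sum_word_mul_rootCapital (G : Gambler μ Q) (k : ℕ) (q : Q) :
    ∑ w : Fin k → A, μ.word (List.ofFn w) * G.rootCapital q (List.ofFn w) =
      G.meanRootCapital k q := by
  induction k generalizing q with
  | zero => simp [μ.word_nil, Gambler.rootCapital, Gambler.meanRootCapital]
  | succ k ih =>
    rw [← (Fin.consEquiv fun _ : Fin (k + 1) => A).sum_comp, Fintype.sum_prod_type,
      Gambler.meanRootCapital]
    refine Finset.sum_congr rfl fun a _ => ?_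
    rw [← ih, Finset.mul_sum, Finset.mul_sum]
    refine Finset.sum_congr rfl fun w _ => ?_
    have hw : List.ofFn (Fin.consEquiv (fun _ => A) (a, w)) = a :: List.ofFn w :=
      List.ofFn_cons a w
    rw [hw, μ.word_cons, Gambler.rootCapital]
    ring

theorem sqrt_le_half_one_add {x : ℝ} (hx : 0 ≤ x) : √x ≤ (1 + x) / 2 := by
  nlinarith [sq_nonneg (1 - √x), Real.sq_sqrt hx]

theorem eq_one_of_half_one_add_le_sqrt {x : ℝ} (hx : 0 ≤ x) (h : (1 + x) / 2 ≤ √x) : x = 1 := by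
  have h1 : (1 - √x) ^ 2 ≤ 0 := by nlinarith [Real.sq_sqrt hx]
  have h2 : 1 - √x = 0 := pow_eq_zero_iff two_ne_zero |>.1 (le_antisymm h1 (sq_nonneg _))
  rw [← Real.sq_sqrt hx, ← sub_eq_zero.1 h2, one_pow]

theorem Gambler.sum_half_one_add_bet (G : Gambler μ Q) (q : Q) :
    ∑ a, μ.prob a * ((1 + G.bet q a) / 2) = 1 := by
  have : ∀ a, μ.prob a * ((1 + G.bet q a) / 2) = (μ.prob a + μ.prob a * G.bet q a) / 2 :=
    fun a => by ring
  simp only [this, ← Finset.sum_div, Finset.sum_add_distrib, μ.sum_prob, G.fair q]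
  norm_num

theorem Gambler.rootBet_le_half (G : Gambler μ Q) (q : Q) (a : A) :
    G.rootBet q a ≤ (1 + G.bet q a) / 2 :=
  (G.rootBet_le q a).trans (sqrt_le_half_one_add (G.bet_nonneg q a))

/-- A weighted mean of `rootBet` is at most the largest weight `v`, with equality only if nothing
is bet and all the weights are `v`. -/
theorem Gambler.bet_eq_one_and_eq_of_sum_rootBet_eq (G : Gambler μ Q) (hμ : μ.IsPositive) (q : Q)
    {f : A → ℝ} {v : ℝ} (hv : 0 < v) (hf : ∀ a, f a ≤ v)
    (h : ∑ a, μ.prob a * (G.rootBet q a * f a) = v) (a : A) : G.bet q a = 1 ∧ f a = v := by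
  have hle : ∀ a, G.rootBet q a * f a ≤ (1 + G.bet q a) / 2 * v := fun a =>
    (mul_le_mul_of_nonneg_left (hf a) (G.rootBet_nonneg q a)).trans
      (mul_le_mul_of_nonneg_right (G.rootBet_le_half q a) hv.le)
  have hsum : ∑ a, μ.prob a * (G.rootBet q a * f a) =
      ∑ a, μ.prob a * ((1 + G.bet q a) / 2 * v) := by
    simp only [h, ← mul_assoc (μ.prob _) ((1 + _) / 2)]
    rw [← Finset.sum_mul, G.sum_half_one_add_bet, one_mul]
  -- Equal sums of termwise ordered terms are equal term by term; positivity of `μ` then cancels the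
  -- weights.
  have heq := (Finset.sum_eq_sum_iff_of_le fun a _ =>
    mul_le_mul_of_nonneg_left (hle a) (μ.prob_nonneg a)).1 hsum a (Finset.mem_univ a)
  have heq' := mul_left_cancel₀ (hμ a).ne' heq
  have hhalf : (1 + G.bet q a) / 2 ≤ G.rootBet q a := by
    refine le_of_mul_le_mul_right ?_ hv
    rw [← heq']
    exact mul_le_mul_of_nonneg_left (hf a) (G.rootBet_nonneg q a)
  have hbet : G.bet q a = 1 :=
    eq_one_of_half_one_add_le_sqrt (G.bet_nonneg q a) (hhalf.trans (G.rootBet_le q a))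
  have hroot : G.rootBet q a = 1 := by
    have := G.rootBet_le_half q a
    rw [hbet] at this hhalf
    linarith
  rw [hroot, hbet] at heq'
  exact ⟨hbet, by linarith⟩

theorem Gambler.meanRootCapital_nonneg (G : Gambler μ Q) (k : ℕ) (q : Q) :
    0 ≤ G.meanRootCapital k q := by
  induction k generalizing q with
  | zero => exact zero_le_one
  | succ k ih =>
    exact Finset.sum_nonneg fun a _ =>
      mul_nonneg (μ.prob_nonneg a) (mul_nonneg (G.rootBet_nonneg q a) (ih _))

theorem Gambler.antitone_meanRootCapital (G : Gambler μ Q) (q : Q) :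
    Antitone fun k => G.meanRootCapital k q := by
  refine antitone_nat_of_succ_le fun k => ?_
  induction k generalizing q with
  | zero =>
    rw [Gambler.meanRootCapital, Gambler.meanRootCapital, ← G.sum_half_one_add_bet q]
    refine Finset.sum_le_sum fun a _ => mul_le_mul_of_nonneg_left ?_ (μ.prob_nonneg a)
    simpa [Gambler.meanRootCapital] using G.rootBet_le_half q a
  | succ k ih =>
    exact Finset.sum_le_sum fun a _ => mul_le_mul_of_nonneg_left
      (mul_le_mul_of_nonneg_left (ih _) (G.rootBet_nonneg q a)) (μ.prob_nonneg a)

/-- A maximum principle: the decreasing limits `g` satisfy the averaging equation `hfix`. At a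
positive maximum nothing is bet and all successors are maxima too, so the state is inert; but there
every factor is 0. -/
theorem Gambler.tendsto_meanRootCapital [Finite Q] (G : Gambler μ Q) (hμ : μ.IsPositive) (q : Q) :
    Tendsto (fun k => G.meanRootCapital k q) atTop (𝓝 0) := by
  have hlim : ∀ q, ∃ l, Tendsto (fun k => G.meanRootCapital k q) atTop (𝓝 l) := fun q =>
    ⟨_, tendsto_atTop_ciInf (G.antitone_meanRootCapital q)
      ⟨0, by rintro _ ⟨k, rfl⟩; exact G.meanRootCapital_nonneg k q⟩⟩
  choose g hg using hlim
  have hfix : ∀ q, ∑ a, μ.prob a * (G.rootBet q a * g (G.step q a)) = g q := fun q =>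
    tendsto_nhds_unique (tendsto_finsetSum _ fun a _ => ((hg _).const_mul _).const_mul _)
      ((tendsto_add_atTop_iff_nat 1).2 (hg q))
  have hg0 : ∀ q, 0 ≤ g q := fun q => ge_of_tendsto' (hg q) fun k => G.meanRootCapital_nonneg k q
  have : Nonempty Q := ⟨q⟩
  obtain ⟨m, hm⟩ := Finite.exists_max g
  suffices hm0 : g m ≤ 0 by
    have : g q = 0 := le_antisymm ((hm q).trans hm0) (hg0 q)
    exact this ▸ hg q
  by_contra hpos
  rw [not_le] at hpos
  have hinert : ∀ (w : List A) (p : Q), g p = g m → ∀ a, G.bet (G.toAutomaton.run p w) a = 1 := by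
    intro w
    induction w with
    | nil =>
      exact fun p hp a =>
        (G.bet_eq_one_and_eq_of_sum_rootBet_eq hμ p hpos (fun _ => hm _) ((hfix p).trans hp) a).1
    | cons b w ih =>
      exact fun p hp a => ih _
        (G.bet_eq_one_and_eq_of_sum_rootBet_eq hμ p hpos (fun _ => hm _) ((hfix p).trans hp) b).2 a
  have : g m = 0 := by
    rw [← hfix m]
    exact Finset.sum_eq_zero fun a _ => by
      rw [G.rootBet_of_inert fun w a => hinert w m rfl a, zero_mul, mul_zero]
  exact hpos.ne' this

/-- The product of the values of `rootBet` along the first `n` letters of `X`. -/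
noncomputable def Gambler.rootCapitalAt (G : Gambler μ Q) (X : ℕ → A) (n : ℕ) : ℝ :=
  ∏ i ∈ Finset.range n, G.rootBet (G.stateAt X i) (X i)

theorem Gambler.rootCapitalAt_nonneg (G : Gambler μ Q) (X : ℕ → A) (n : ℕ) :
    0 ≤ G.rootCapitalAt X n :=
  Finset.prod_nonneg fun _ _ => G.rootBet_nonneg _ _

theorem Gambler.rootCapitalAt_add (G : Gambler μ Q) (X : ℕ → A) (n k : ℕ) :
    G.rootCapitalAt X (n + k) =
      G.rootCapitalAt X n * G.rootCapital (G.stateAt X n) (window X n k) := by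
  induction k generalizing n with
  | zero => simp [window_zero, Gambler.rootCapital]
  | succ k ih =>
    rw [window_succ_left, Gambler.rootCapital, ← Nat.add_assoc, Nat.add_right_comm, ih,
      Gambler.stateAt_succ, ← mul_assoc, Gambler.rootCapitalAt, Finset.prod_range_succ]
    rfl

theorem Gambler.capitalAt_eq_sq (G : Gambler μ Q) (X : ℕ → A)
    (h : ∀ n, ¬ G.Inert (G.stateAt X n)) (n : ℕ) :
    G.capitalAt X n = G.rootCapitalAt X n ^ 2 := by
  rw [Gambler.capitalAt_eq_prod, Gambler.rootCapitalAt, ← Finset.prod_pow]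
  refine Finset.prod_congr rfl fun i _ => ?_
  rw [Gambler.rootBet, if_neg (G.stateAt_succ X i ▸ h (i + 1)), Real.sq_sqrt (G.bet_nonneg _ _)]

theorem Gambler.exists_rootBet_le [Finite Q] (G : Gambler μ Q) :
    ∃ B : ℝ, 1 ≤ B ∧ ∀ q a, G.rootBet q a ≤ B := by
  obtain ⟨B, hB⟩ := (Set.finite_range fun p : Q × A => G.rootBet p.1 p.2).bddAbove
  exact ⟨max 1 B, le_max_left _ _, fun q a => (hB ⟨(q, a), rfl⟩).trans (le_max_right _ _)⟩

theorem Gambler.rootCapitalAt_add_le (G : Gambler μ Q) (X : ℕ → A) {B : ℝ}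
    (hB : ∀ q a, G.rootBet q a ≤ B) (n k : ℕ) :
    G.rootCapitalAt X (n + k) ≤ B ^ k * G.rootCapitalAt X n := by
  rw [Gambler.rootCapitalAt, Finset.prod_range_add, mul_comm]
  refine mul_le_mul_of_nonneg_right ?_ (G.rootCapitalAt_nonneg X n)
  calc _ ≤ ∏ _i ∈ Finset.range k, B :=
        Finset.prod_le_prod (fun _ _ => G.rootBet_nonneg _ _) fun _ _ => hB _ _
    _ = B ^ k := by simp

/-- If the products of the factors gained on all windows of length `k` are at most `1`, then the
products of `k` consecutive values of a sequence stay bounded. -/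
theorem prod_range_add_le_of_prod_le_one {d r : ℕ → ℝ} {k n : ℕ} (hd : ∀ i, 0 < d i)
    (hr : ∀ i, d (i + k) = d i * r i) (h : ∏ i ∈ Finset.range n, r i ≤ 1) :
    ∏ i ∈ Finset.range k, d (n + i) ≤ ∏ i ∈ Finset.range k, d i := by
  have hP : 0 < ∏ i ∈ Finset.range n, d i := Finset.prod_pos fun i _ => hd i
  refine le_of_mul_le_mul_left ?_ hP
  -- The product of the first `n + k` values is split after `n` and after `k` factors.
  rw [← Finset.prod_range_add, Nat.add_comm, Finset.prod_range_add, mul_comm]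
  refine mul_le_mul_of_nonneg_right ?_ (Finset.prod_nonneg fun i _ => (hd i).le)
  simp only [Nat.add_comm k, hr, Finset.prod_mul_distrib]
  exact mul_le_of_le_one_right hP.le h

/-- Summing over all states removes the dependence on the state; then `x ≤ exp (x - 1)` turns an
average below 1 into a product at most 1. -/
theorem IsNormal.eventually_prod_rootCapital_le_one [DecidableEq A] [Finite Q] (G : Gambler μ Q)
    (hμ : μ.IsPositive) {X : ℕ → A} (hX : IsNormal μ X) :
    ∃ k, 0 < k ∧ ∀ᶠ n in atTop,
      ∏ i ∈ Finset.range n, G.rootCapital (G.stateAt X i) (window X i k) ≤ 1 := by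
  have := Fintype.ofFinite Q
  have hsum : Tendsto (fun k => ∑ q, G.meanRootCapital k q) atTop (𝓝 0) := by
    simpa using tendsto_finsetSum Finset.univ fun q _ => G.tendsto_meanRootCapital hμ q
  obtain ⟨k, hk1, hk0⟩ :=
    ((hsum.eventually_lt_const one_pos).and (eventually_gt_atTop 0)).exists
  refine ⟨k, hk0, ?_⟩
  set S : List A → ℝ := fun w => ∑ q, G.rootCapital q w with hS
  have hmean : ∑ w : Fin k → A, μ.word (List.ofFn w) * S (List.ofFn w) < 1 := by
    simp only [hS, Finset.mul_sum]
    rw [Finset.sum_comm]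
    simpa only [G.sum_word_mul_rootCapital] using hk1
  filter_upwards [(hX.tendsto_mean k S).eventually_lt_const hmean, eventually_gt_atTop 0]
    with n hn hn0
  have hn' : (0 : ℝ) < n := Nat.cast_pos.2 hn0
  rw [div_lt_one hn'] at hn
  calc ∏ i ∈ Finset.range n, G.rootCapital (G.stateAt X i) (window X i k)
      ≤ ∏ i ∈ Finset.range n, Real.exp (S (window X i k) - 1) := by
        refine Finset.prod_le_prod (fun i _ => G.rootCapital_nonneg _ _) fun i _ => ?_
        have h1 : G.rootCapital (G.stateAt X i) (window X i k) ≤ S (window X i k) :=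
          Finset.single_le_sum (f := fun q => G.rootCapital q (window X i k))
            (fun q _ => G.rootCapital_nonneg _ q) (Finset.mem_univ (G.stateAt X i))
        linarith [Real.add_one_le_exp (S (window X i k) - 1)]
    _ = Real.exp (∑ i ∈ Finset.range n, S (window X i k) - n) := by
        rw [← Real.exp_sum, Finset.sum_sub_distrib]
        simp
    _ ≤ 1 := Real.exp_le_one_iff.2 (by linarith)

theorem IsNormal.exists_rootCapitalAt_le [DecidableEq A] [Finite Q] (G : Gambler μ Q)
    (hμ : μ.IsPositive) {X : ℕ → A} (hX : IsNormal μ X) :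
    ∃ C : ℝ, ∀ᶠ n in atTop, G.rootCapitalAt X n ≤ C := by
  obtain ⟨B, hB1, hB⟩ := G.exists_rootBet_le
  -- Telescoping divides by root capitals; once one vanishes, all later ones do.
  by_cases hzero : ∃ m, G.rootCapitalAt X m = 0
  · obtain ⟨m, hm⟩ := hzero
    refine ⟨0, ?_⟩
    filter_upwards [eventually_ge_atTop m] with n hn
    obtain ⟨j, rfl⟩ := Nat.exists_eq_add_of_le hn
    rw [G.rootCapitalAt_add, hm, zero_mul]
  have hpos : ∀ n, 0 < G.rootCapitalAt X n := fun n =>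
    lt_of_le_of_ne (G.rootCapitalAt_nonneg X n) fun h => hzero ⟨n, h.symm⟩
  obtain ⟨k, hk0, hk⟩ := hX.eventually_prod_rootCapital_le_one G hμ
  set K := ∏ i ∈ Finset.range k, G.rootCapitalAt X i
  refine ⟨max 1 ((B ^ k) ^ k * K), ?_⟩
  rw [← map_add_atTop_eq_nat k, eventually_map]
  filter_upwards [hk] with n hn
  have hbound := prod_range_add_le_of_prod_le_one hpos (fun i => G.rootCapitalAt_add X i k) hn
  rcases le_total (G.rootCapitalAt X (n + k)) 1 with h1 | h1
  · exact h1.trans (le_max_left _ _)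
  refine le_trans ?_ (le_max_right _ _)
  -- Each of the `k` preceding root capitals is at least `B ^ (-k)` times this one, so their bounded
  -- product bounds its `k`-th power.
  calc G.rootCapitalAt X (n + k)
      ≤ G.rootCapitalAt X (n + k) ^ k := le_self_pow₀ h1 hk0.ne'
    _ = ∏ _i ∈ Finset.range k, G.rootCapitalAt X (n + k) := by simp
    _ ≤ ∏ i ∈ Finset.range k, (B ^ k * G.rootCapitalAt X (n + i)) := by
        refine Finset.prod_le_prod (fun _ _ => (hpos _).le) fun i hi => ?_
        have hik := (Finset.mem_range.1 hi).le
        have h2 := G.rootCapitalAt_add_le X hB (n + i) (k - i)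
        rw [Nat.add_assoc, Nat.add_sub_cancel' hik] at h2
        exact h2.trans (mul_le_mul_of_nonneg_right
          (pow_le_pow_right₀ hB1 (Nat.sub_le k i)) (hpos _).le)
    _ = (B ^ k) ^ k * ∏ i ∈ Finset.range k, G.rootCapitalAt X (n + i) := by
        simp [Finset.prod_mul_distrib]
    _ ≤ (B ^ k) ^ k * K := mul_le_mul_of_nonneg_left hbound (by positivity)

theorem IsNormal.not_winsAgainst [DecidableEq A] [Finite Q] (G : Gambler μ Q)
    (hμ : μ.IsPositive) {X : ℕ → A} (hX : IsNormal μ X) : ¬ G.WinsAgainst X := by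
  by_cases h : ∃ m, G.Inert (G.stateAt X m)
  · obtain ⟨m, hm⟩ := h
    have key : ∀ j, G.Inert (G.stateAt X (m + j)) ∧ G.capitalAt X (m + j) = G.capitalAt X m := by
      intro j
      induction j with
      | zero => exact ⟨hm, rfl⟩
      | succ j ih =>
        rw [← Nat.add_assoc, G.stateAt_succ, G.capitalAt_succ, ih.1.bet_eq_one, ih.2, mul_one]
        exact ⟨ih.1.step _, rfl⟩
    apply G.not_winsAgainst_of_eventually_le X (G.capitalAt X m)
    filter_upwards [eventually_ge_atTop m] with n hn
    obtain ⟨j, rfl⟩ := Nat.exists_eq_add_of_le hn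
    exact (key j).2.le
  · obtain ⟨C, hC⟩ := hX.exists_rootCapitalAt_le G hμ
    apply G.not_winsAgainst_of_eventually_le X (C ^ 2)
    filter_upwards [hC] with n hn
    rw [G.capitalAt_eq_sq X (not_exists.1 h)]
    exact pow_le_pow_left₀ (G.rootCapitalAt_nonneg X n) hn 2

end

end BernoulliGambling

theorem mainTheorem3 {A : Type*} [Fintype A] [DecidableEq A]
    (μ : BernoulliGambling.LetterDistribution A) (hμ : μ.IsPositive) (X : ℕ → A) :
    BernoulliGambling.IsNormal μ X ↔
      ∀ (Q : Type*) [Finite Q] (G : BernoulliGambling.Gambler μ Q), ¬ G.WinsAgainst X := by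
  refine ⟨fun h Q _ G => h.not_winsAgainst G hμ, fun h => ?_⟩
  refine BernoulliGambling.isNormal_of_suffixGambler μ X fun u a ε hε hw => ?_
  have : Finite {l : List A // l.length ≤ u.length} := List.finite_length_le A u.length
  obtain ⟨n, ⟨e⟩⟩ := Finite.exists_equiv_fin {l : List A // l.length ≤ u.length}
  -- The states are renamed to a copy of `Fin n` in the universe over which `Q` ranges.
  exact h (ULift (Fin n)) _
    ((BernoulliGambling.Gambler.winsAgainst_rename_iff _ (e.trans Equiv.ulift.symm) X).2 hw)
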